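/- There exist constants $C_1, C_2, C_3 \ge 0$ such that, for every real-valued $u \in C^\infty_c(\mathbb{R};\mathbb{R})$, $$\| u \|_{\dot W^{1/2,4}(\mathbb{R})} \le C_1 \| u u' \|_{L^2(\mathbb{R})}^{1/2}, \qquad \| u' \|_{L^4(\mathbb{R})} \le C_2 \| u u'' \|_{L^2(\mathbb{R})}^{1/2}, \qquad \| u' \|_{L^6(\mathbb{R})} \le C_3 \| u u' u'' \|_{L^2(\mathbb{R})}^{1/3},$$ where $\| u \|_{\dot W^{1/2,4}(\mathbb{R})}$ is the homogeneous fractional Sobolev (Gagliardo) semi-norm $$\| u \|_{\dot W^{1/2,4}(\mathbb{R})} := \left( \int_{\mathbb{R}} \int_{\mathbb{R}} \frac{|u(x)-u(y)|^4}{|x-y|^{3}} \, dy \, dx \right)^{1/4}.$$ -/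

import Mathlib

open MeasureTheory
open scoped ENNReal NNReal ContDiff

/-- The homogeneous fractional Sobolev (Gagliardo, or Sobolev-Slobodeckij) semi-norm of order
`s ∈ (0,1)` and exponent `p ∈ [1,∞)` of a function on the real line,
`(∫∫ |u(x) - u(y)|^p / |x - y|^(1 + s p) dy dx)^(1/p)`, as an element of `[0,∞]`. -/
noncomputable def gagliardoSeminorm (s p : ℝ) (u : ℝ → ℝ) : ℝ≥0∞ :=
  (∫⁻ x : ℝ, ∫⁻ y : ℝ, ‖u x - u y‖ₑ ^ p / ‖x - y‖ₑ ^ (1 + s * p)) ^ (1 / p)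

/-! The second and third inequalities are integration by parts. The derivative of `u * u' ^ (2m+3)`
integrates to zero, and Young's inequality absorbs its mixed term into the integral of `u' ^ (2m+4)`
(`integral_deriv_pow_le`). The cases `m = 0, 1` give the exponents 4 and 6.

For the Gagliardo bound, symmetry reduces to pairs with `|u x| ≤ |u y|`. Since `(u²)' = 2 u u'`, the
product `|u x - u y| |u y|` is at most `4 |x - y| M(y)`, with `M` the maximal function of `|u u'|`
(`abs_sub_mul_abs_le_centredMaximal`). This controls the kernel near `y`, while `|u x - u y| ≤ 2 |u
y|` controls it far away; the crossover length is `R = u(y)² / M(y)`. Integrating in `x` leaves a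
multiple of `M(y)²` (`lintegral_indicator_kernel_le`), and the `L²` bound for the maximal function
concludes. -/

lemma rpow_inv_le_of_le_mul {X Y K : ℝ≥0∞} {p : ℝ} (hp : 0 < p) (h : X ≤ K * Y) :
    X ^ (1 / p) ≤ K ^ (1 / p) * (Y ^ (1 / 2 : ℝ)) ^ (2 / p) := by
  rw [← ENNReal.rpow_mul, show (1 / 2 : ℝ) * (2 / p) = 1 / p by ring,
    ← ENNReal.mul_rpow_of_nonneg _ _ (by positivity)]
  exact ENNReal.rpow_le_rpow h (by positivity)

lemma eLpNorm_two_eq_lintegral (f : ℝ → ℝ) :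
    eLpNorm f 2 volume = (∫⁻ x, ‖f x‖ₑ ^ (2 : ℝ)) ^ (1 / 2 : ℝ) := by
  rw [eLpNorm_eq_lintegral_rpow_enorm_toReal two_ne_zero ENNReal.ofNat_ne_top]
  simp

/-! ### Derivative bounds by integration by parts. -/

/-- Integrating the derivative of `u * u' ^ n` and absorbing the mixed term. -/
lemma integral_deriv_pow_le {u : ℝ → ℝ} (hu : ContDiff ℝ ∞ u) (hc : HasCompactSupport u)
    (m : ℕ) :
    ∫ x, (deriv u x ^ (m + 2)) ^ 2 ≤ (2 * m + 3 : ℝ) ^ 2 *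
      ∫ x, (u x * deriv u x ^ m * deriv (deriv u) x) ^ 2 := by
  have h1 : ContDiff ℝ ∞ (deriv u) := hu.deriv'
  have h2 : ContDiff ℝ ∞ (deriv (deriv u)) := h1.deriv'
  have c0 := hu.continuous
  have c1 := h1.continuous
  have c2 := h2.continuous
  have hder : ∀ x, HasDerivAt (fun x => u x * deriv u x ^ (2 * m + 3))
      ((deriv u x ^ (m + 2)) ^ 2
        + (2 * m + 3) * ((u x * deriv u x ^ m * deriv (deriv u) x) * deriv u x ^ (m + 2))) x := by
    intro x
    have d0 := (hu.differentiable (by simp) x).hasDerivAt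
    have d1 := (h1.differentiable (by simp) x).hasDerivAt
    refine (d0.mul (d1.pow (2 * m + 3))).congr_deriv ?_
    push_cast
    simp only [Pi.pow_apply]
    ring
  have s1 : HasCompactSupport (fun x => u x * deriv u x ^ (2 * m + 3)) := hc.mul_right
  have s2 : HasCompactSupport (fun x => (deriv u x ^ (m + 2)) ^ 2) := by
    refine hc.deriv.comp_left (g := fun t => (t ^ (m + 2)) ^ 2) ?_
    simp
  have s3 : HasCompactSupport (fun x => u x * deriv u x ^ m * deriv (deriv u) x) :=
    hc.mul_right.mul_right
  have s4 : HasCompactSupport (fun x => (u x * deriv u x ^ m * deriv (deriv u) x) ^ 2) := by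
    refine s3.comp_left (g := fun t => t ^ 2) ?_
    simp
  have i2 : Integrable (fun x => (deriv u x ^ (m + 2)) ^ 2) :=
    Continuous.integrable_of_hasCompactSupport (by fun_prop) s2
  have i4 : Integrable (fun x => (u x * deriv u x ^ m * deriv (deriv u) x) ^ 2) :=
    Continuous.integrable_of_hasCompactSupport (by fun_prop) s4
  have i5 : Integrable (fun x => (u x * deriv u x ^ m * deriv (deriv u) x)
      * deriv u x ^ (m + 2)) :=
    Continuous.integrable_of_hasCompactSupport (by fun_prop) s3.mul_right
  have key := integral_eq_zero_of_hasDerivAt_of_integrable hder (i2.add (i5.const_mul _))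
    (Continuous.integrable_of_hasCompactSupport (by fun_prop) s1)
  -- With `P = u' ^ (m+2)`, `Q = u u' ^ m u''` and `k = 2m+3`, this is `P²/2 - k² Q²/2 ≤ P² + k Q
  -- P`, that is, `(P + k Q)² ≥ 0`. The right side has integral zero.
  have mono := integral_mono (μ := volume)
    (f := fun x => (1 / 2 : ℝ) * (deriv u x ^ (m + 2)) ^ 2
      - ((2 * m + 3 : ℝ) ^ 2 / 2) * (u x * deriv u x ^ m * deriv (deriv u) x) ^ 2)
    ((i2.const_mul _).sub (i4.const_mul _)) (i2.add (i5.const_mul (2 * m + 3 : ℝ)))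
    (fun x => by
      simp only [Pi.add_apply]
      nlinarith [sq_nonneg (deriv u x ^ (m + 2)
        + (2 * m + 3 : ℝ) * (u x * deriv u x ^ m * deriv (deriv u) x))])
  simp only [Pi.add_apply] at mono
  rw [key, integral_sub (i2.const_mul _) (i4.const_mul _), integral_const_mul,
    integral_const_mul] at mono
  linarith

lemma lintegral_deriv_pow_le {u : ℝ → ℝ} (hu : ContDiff ℝ ∞ u) (hc : HasCompactSupport u)
    (m : ℕ) :
    ∫⁻ x, ‖deriv u x‖ₑ ^ ((2 * m + 4 : ℕ) : ℝ) ≤ ((2 * m + 3 : ℝ≥0) ^ 2 : ℝ≥0) *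
      ∫⁻ x, ‖u x * deriv u x ^ m * deriv (deriv u) x‖ₑ ^ (2 : ℝ) := by
  have h1 : ContDiff ℝ ∞ (deriv u) := hu.deriv'
  have h2 : ContDiff ℝ ∞ (deriv (deriv u)) := h1.deriv'
  have c0 := hu.continuous
  have c1 := h1.continuous
  have c2 := h2.continuous
  have s2 : HasCompactSupport (fun x => (deriv u x ^ (m + 2)) ^ 2) := by
    refine hc.deriv.comp_left (g := fun t => (t ^ (m + 2)) ^ 2) ?_
    simp
  have s3 : HasCompactSupport (fun x => u x * deriv u x ^ m * deriv (deriv u) x) :=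
    hc.mul_right.mul_right
  have s4 : HasCompactSupport (fun x => (u x * deriv u x ^ m * deriv (deriv u) x) ^ 2) := by
    refine s3.comp_left (g := fun t => t ^ 2) ?_
    simp
  have e1 : ∫⁻ x, ‖deriv u x‖ₑ ^ ((2 * m + 4 : ℕ) : ℝ)
      = ENNReal.ofReal (∫ x, (deriv u x ^ (m + 2)) ^ 2) := by
    rw [ofReal_integral_eq_lintegral_ofReal
      (Continuous.integrable_of_hasCompactSupport (by fun_prop) s2)
      (Filter.Eventually.of_forall fun x => by positivity)]
    refine lintegral_congr fun x => ?_
    rw [ENNReal.rpow_natCast, Real.enorm_eq_ofReal_abs, ← ENNReal.ofReal_pow (abs_nonneg _),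
      ← pow_mul, show (m + 2) * 2 = 2 * m + 4 by ring, Even.pow_abs ⟨m + 2, by ring⟩]
  have e2 : ∫⁻ x, ‖u x * deriv u x ^ m * deriv (deriv u) x‖ₑ ^ (2 : ℝ)
      = ENNReal.ofReal (∫ x, (u x * deriv u x ^ m * deriv (deriv u) x) ^ 2) := by
    rw [ofReal_integral_eq_lintegral_ofReal
      (Continuous.integrable_of_hasCompactSupport (by fun_prop) s4)
      (Filter.Eventually.of_forall fun x => by positivity)]
    refine lintegral_congr fun x => ?_
    rw [ENNReal.rpow_ofNat, Real.enorm_eq_ofReal_abs, ← ENNReal.ofReal_pow (abs_nonneg _), sq_abs]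
  rw [e1, e2, ← ENNReal.ofReal_coe_nnreal, ← ENNReal.ofReal_mul (by positivity)]
  exact ENNReal.ofReal_le_ofReal (by simpa using integral_deriv_pow_le hu hc m)

lemma eLpNorm_deriv_le {u : ℝ → ℝ} (hu : ContDiff ℝ ∞ u) (hc : HasCompactSupport u) (m : ℕ) :
    eLpNorm (deriv u) (2 * m + 4 : ℕ) volume
      ≤ (((2 * m + 3 : ℝ≥0) ^ 2) ^ (1 / ((2 * m + 4 : ℕ) : ℝ)) : ℝ≥0) *
        eLpNorm (fun x => u x * deriv u x ^ m * deriv (deriv u) x) 2 volume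
          ^ (2 / ((2 * m + 4 : ℕ) : ℝ)) := by
  rw [eLpNorm_two_eq_lintegral, eLpNorm_eq_lintegral_rpow_enorm_toReal (by simp)
      (ENNReal.natCast_ne_top _),
    ENNReal.toReal_natCast, ENNReal.coe_rpow_of_nonneg _ (by positivity)]
  exact rpow_inv_le_of_le_mul (by positivity) (lintegral_deriv_pow_le hu hc m)

/-! ### The maximal function and its `L²` bound. -/

/-- The (centred) Hardy-Littlewood maximal function on the real line, normalised by the radius. -/
noncomputable def centredMaximal (f : ℝ → ℝ≥0∞) (x : ℝ) : ℝ≥0∞ :=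
  ⨆ (r : ℝ) (_ : 0 < r), (∫⁻ y in Metric.closedBall x r, f y) / ENNReal.ofReal r

lemma lt_centredMaximal_iff {f : ℝ → ℝ≥0∞} {x : ℝ} {l : ℝ≥0∞} :
    l < centredMaximal f x ↔
      ∃ r : ℝ, 0 < r ∧ l * ENNReal.ofReal r < ∫⁻ y in Metric.closedBall x r, f y := by
  simp only [centredMaximal, lt_iSup_iff, exists_prop]
  refine exists_congr fun r => and_congr_right fun hr => ?_
  rw [ENNReal.lt_div_iff_mul_lt (by simp [hr]) (by simp)]

lemma lintegral_closedBall_le (f : ℝ → ℝ≥0∞) (x : ℝ) {r : ℝ} (hr : 0 < r) :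
    ∫⁻ y in Metric.closedBall x r, f y ≤ centredMaximal f x * ENNReal.ofReal r := by
  rw [← ENNReal.div_le_iff (by simp [hr]) (by simp)]
  exact le_iSup₂ (f := fun (r : ℝ) (_ : 0 < r) =>
    (∫⁻ y in Metric.closedBall x r, f y) / ENNReal.ofReal r) r hr

lemma isOpen_lt_centredMaximal (f : ℝ → ℝ≥0∞) (l : ℝ≥0∞) :
    IsOpen {x | l < centredMaximal f x} := by
  rw [Metric.isOpen_iff]
  intro x hx
  obtain ⟨r, hr, h⟩ := lt_centredMaximal_iff.1 hx
  have hl : l ≠ ⊤ := (hx.trans_le le_top).ne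
  have hcont : Continuous fun s : ℝ => l * ENNReal.ofReal s :=
    (ENNReal.continuous_const_mul hl).comp ENNReal.continuous_ofReal
  obtain ⟨e, he, H⟩ := Metric.isOpen_iff.1 (isOpen_lt hcont continuous_const) r h
  -- The strict inequality leaves room to enlarge the radius by `e / 2`, so that the new ball about
  -- `y` still contains the old one about `x`.
  refine ⟨e / 2, by positivity, fun y hy => lt_centredMaximal_iff.2 ⟨r + e / 2, by positivity, ?_⟩⟩
  have hs : r + e / 2 ∈ Metric.ball r e := by
    rw [Metric.mem_ball, Real.dist_eq, add_sub_cancel_left, abs_of_pos (by positivity)]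
    linarith
  refine (H hs).trans_le (lintegral_mono_set (Metric.closedBall_subset_closedBall' ?_))
  rw [dist_comm]
  linarith [Metric.mem_ball.1 hy]

lemma measurable_centredMaximal (f : ℝ → ℝ≥0∞) : Measurable (centredMaximal f) :=
  measurable_of_Ioi fun l => (isOpen_lt_centredMaximal f l).measurableSet

lemma centredMaximal_le_of_le {f : ℝ → ℝ≥0∞} {c : ℝ≥0∞} (h : ∀ x, f x ≤ c) (x : ℝ) :
    centredMaximal f x ≤ 2 * c := by
  refine iSup₂_le fun r hr => ?_
  rw [ENNReal.div_le_iff (by simp [hr]) (by simp)]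
  calc ∫⁻ y in Metric.closedBall x r, f y ≤ ∫⁻ _ in Metric.closedBall x r, c :=
        lintegral_mono h
    _ = 2 * c * ENNReal.ofReal r := by
      rw [setLIntegral_const, Real.volume_closedBall, ENNReal.ofReal_mul zero_le_two]
      simp only [ENNReal.ofReal_ofNat]
      ring

lemma centredMaximal_add_const_le {f g : ℝ → ℝ≥0∞} {c : ℝ≥0∞} (h : ∀ x, f x ≤ g x + c) (x : ℝ) :
    centredMaximal f x ≤ centredMaximal g x + 2 * c := by
  refine iSup₂_le fun r hr => ?_
  rw [ENNReal.div_le_iff (by simp [hr]) (by simp)]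
  calc ∫⁻ y in Metric.closedBall x r, f y ≤ ∫⁻ y in Metric.closedBall x r, (g y + c) :=
        lintegral_mono h
    _ = (∫⁻ y in Metric.closedBall x r, g y) + 2 * c * ENNReal.ofReal r := by
      rw [lintegral_add_right _ measurable_const, setLIntegral_const, Real.volume_closedBall,
        ENNReal.ofReal_mul zero_le_two]
      simp only [ENNReal.ofReal_ofNat]
      ring
    _ ≤ _ := by
      rw [add_mul]
      gcongr
      exact lintegral_closedBall_le g x hr

/-- The weak type `(1, 1)` inequality. -/
lemma mul_volume_lt_centredMaximal_le (f : ℝ → ℝ≥0∞) {l : ℝ≥0∞} (hl : l ≠ 0) :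
    l * volume {x | l < centredMaximal f x} ≤ 10 * ∫⁻ x, f x := by
  by_cases hf : ∫⁻ x, f x = ⊤
  · simp [hf]
  by_cases hl' : l = ⊤
  · simp [hl']
  have hex : ∀ x : ℝ, ∃ r : ℝ, l < centredMaximal f x →
      0 < r ∧ l * ENNReal.ofReal r < ∫⁻ y in Metric.closedBall x r, f y := fun x => by
    by_cases h : l < centredMaximal f x
    · obtain ⟨r, hr⟩ := lt_centredMaximal_iff.1 h
      exact ⟨r, fun _ => hr⟩
    · exact ⟨0, fun h' => absurd h' h⟩
  choose r hr using hex
  have hbound : ∀ a ∈ {x | l < centredMaximal f x}, r a ≤ ((∫⁻ x, f x) / l).toReal := by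
    intro a ha
    rw [← ENNReal.ofReal_le_iff_le_toReal (ENNReal.div_ne_top hf hl),
      ENNReal.le_div_iff_mul_le (Or.inl hl) (Or.inl hl'), mul_comm]
    exact (hr a ha).2.le.trans (setLIntegral_le_lintegral _ _)
  -- Enlarging by 5 costs the factor 10 below, because a ball of radius `5 r` has length `10 r`.
  obtain ⟨s, hs, hdisj, hcov⟩ := Vitali.exists_disjoint_subfamily_covering_enlargement_closedBall
    {x | l < centredMaximal f x} (fun x => x) r _ hbound 5 (by norm_num)
  have hcount : s.Countable := hdisj.countable_of_nonempty_interior fun a ha => by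
    rw [interior_closedBall _ (hr a (hs ha)).1.ne']
    exact Metric.nonempty_ball.2 (hr a (hs ha)).1
  have hsub : {x | l < centredMaximal f x} ⊆ ⋃ b ∈ s, Metric.closedBall b (5 * r b) := by
    intro a ha
    obtain ⟨b, hb, hab⟩ := hcov a ha
    exact Set.mem_biUnion hb (hab (Metric.mem_closedBall_self (hr a ha).1.le))
  have := hcount.to_subtype
  calc l * volume {x | l < centredMaximal f x}
      ≤ l * ∑' b : s, volume (Metric.closedBall (b : ℝ) (5 * r b)) := by
        gcongr
        exact (measure_mono hsub).trans (measure_biUnion_le _ hcount _)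
    _ = 10 * ∑' b : s, l * ENNReal.ofReal (r b) := by
        rw [← ENNReal.tsum_mul_left, ← ENNReal.tsum_mul_left]
        refine tsum_congr fun b => ?_
        rw [Real.volume_closedBall, ← mul_assoc, ENNReal.ofReal_mul (by norm_num)]
        norm_num
        ring
    _ ≤ 10 * ∑' b : s, ∫⁻ y in Metric.closedBall (b : ℝ) (r b), f y := by
        gcongr with b
        exact (hr b (hs b.2)).2.le
    _ = 10 * ∫⁻ y in ⋃ b ∈ s, Metric.closedBall b (r b), f y := by
        rw [lintegral_biUnion hcount (fun _ _ => Metric.isClosed_closedBall.measurableSet) hdisj]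
    _ ≤ 10 * ∫⁻ x, f x := by
        gcongr
        exact Measure.restrict_le_self

/-- Truncation: the part of `f` below `t / 4` contributes at most `t / 2` to the maximal function,
so the weak bound at level `t / 2` is needed only for the part above `t / 4`. -/
lemma ofReal_mul_volume_lt_centredMaximal_le {f : ℝ → ℝ≥0∞} {t : ℝ} (ht : 0 < t) :
    volume {x | ENNReal.ofReal t < centredMaximal f x} * ENNReal.ofReal t
      ≤ 20 * ∫⁻ x, {x | ENNReal.ofReal t ≤ 4 * f x}.indicator f x := by
  set g : ℝ → ℝ≥0∞ := {x | ENNReal.ofReal t ≤ 4 * f x}.indicator f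
  have hfg : ∀ x, f x ≤ g x + ENNReal.ofReal t / 4 := by
    intro x
    by_cases hx : ENNReal.ofReal t ≤ 4 * f x
    · simp [g, hx]
    · simp only [g, Set.indicator, Set.mem_ofPred_eq, hx, if_false, zero_add]
      rw [ENNReal.le_div_iff_mul_le (by simp) (by simp), mul_comm]
      exact (not_le.1 hx).le
  have hsub : {x | ENNReal.ofReal t < centredMaximal f x}
      ⊆ {x | ENNReal.ofReal (t / 2) < centredMaximal g x} := by
    intro x hx
    have h1 := lt_of_lt_of_le hx (centredMaximal_add_const_le hfg x)
    have e1 : 2 * (ENNReal.ofReal t / 4) = ENNReal.ofReal (t / 2) := by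
      rw [← ENNReal.ofReal_ofNat 4, ← ENNReal.ofReal_div_of_pos (by norm_num),
        ← ENNReal.ofReal_ofNat 2, ← ENNReal.ofReal_mul (by norm_num)]
      congr 1
      ring
    rw [e1, show ENNReal.ofReal t = ENNReal.ofReal (t / 2) + ENNReal.ofReal (t / 2) by
      rw [← ENNReal.ofReal_add (by positivity) (by positivity), add_halves]] at h1
    exact lt_of_add_lt_add_right h1
  have hw := mul_volume_lt_centredMaximal_le g (l := ENNReal.ofReal (t / 2)) (by simpa using ht)
  calc volume {x | ENNReal.ofReal t < centredMaximal f x} * ENNReal.ofReal t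
      ≤ volume {x | ENNReal.ofReal (t / 2) < centredMaximal g x} * ENNReal.ofReal t := by gcongr
    _ = 2 * (ENNReal.ofReal (t / 2) * volume {x | ENNReal.ofReal (t / 2) < centredMaximal g x}) := by
      rw [← mul_assoc, ← ENNReal.ofReal_ofNat 2, ← ENNReal.ofReal_mul (by norm_num), mul_comm]
      congr 2
      ring
    _ ≤ 2 * (10 * ∫⁻ x, g x) := by gcongr
    _ = _ := by rw [← mul_assoc]; norm_num

/-- The strong type `(2, 2)` inequality, for bounded functions. -/
lemma lintegral_centredMaximal_sq_le {f : ℝ → ℝ≥0∞} (hf : Measurable f) {c : ℝ≥0∞} (hc : c ≠ ⊤)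
    (hfc : ∀ x, f x ≤ c) :
    ∫⁻ x, centredMaximal f x ^ 2 ≤ 160 * ∫⁻ x, f x ^ 2 := by
  have hfin : ∀ x, centredMaximal f x ≠ ⊤ := fun x =>
    ((centredMaximal_le_of_le hfc x).trans_lt (ENNReal.mul_lt_top (by simp) hc.lt_top)).ne
  have hlayer := lintegral_rpow_eq_lintegral_meas_lt_mul volume
    (f := fun x => (centredMaximal f x).toReal) (Filter.Eventually.of_forall fun x => by simp)
    (measurable_centredMaximal f).ennreal_toReal.aemeasurable (p := 2) two_pos
  have e1 : ∫⁻ x, centredMaximal f x ^ 2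
      = ∫⁻ x, ENNReal.ofReal ((centredMaximal f x).toReal ^ (2 : ℝ)) := by
    refine lintegral_congr fun x => ?_
    rw [Real.rpow_two, ENNReal.ofReal_pow (by simp), ENNReal.ofReal_toReal (hfin x)]
  have hmeas : MeasurableSet {p : ℝ × ℝ | ENNReal.ofReal p.1 ≤ 4 * f p.2} :=
    measurableSet_le (by fun_prop) (by fun_prop)
  have hm2 : Measurable (fun p : ℝ × ℝ =>
      {x | ENNReal.ofReal p.1 ≤ 4 * f x}.indicator f p.2) :=
    (hf.comp measurable_snd).indicator hmeas
  -- Layer cake, then Tonelli: for fixed `x` only levels `t ≤ 4 f x` contribute, whence `2 * 20 * 4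
  -- = 160`.
  rw [e1, hlayer]
  calc ENNReal.ofReal 2 * ∫⁻ t in Set.Ioi 0,
        volume {x | t < (centredMaximal f x).toReal} * ENNReal.ofReal (t ^ ((2 : ℝ) - 1))
      ≤ ENNReal.ofReal 2 * ∫⁻ t in Set.Ioi (0 : ℝ),
        20 * ∫⁻ x, {x | ENNReal.ofReal t ≤ 4 * f x}.indicator f x := by
        gcongr ENNReal.ofReal 2 * ?_
        refine setLIntegral_mono' measurableSet_Ioi fun t ht => ?_
        have e2 : {x | t < (centredMaximal f x).toReal}
            = {x | ENNReal.ofReal t < centredMaximal f x} := by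
          ext x
          exact (ENNReal.ofReal_lt_iff_lt_toReal (le_of_lt ht) (hfin x)).symm
        rw [e2, show (2 : ℝ) - 1 = 1 by norm_num, Real.rpow_one]
        exact ofReal_mul_volume_lt_centredMaximal_le ht
    _ = 40 * ∫⁻ x, ∫⁻ t in Set.Ioi (0 : ℝ),
        {x | ENNReal.ofReal t ≤ 4 * f x}.indicator f x := by
        rw [lintegral_const_mul _ hm2.lintegral_prod_right', ← mul_assoc,
          lintegral_lintegral_swap hm2.aemeasurable]
        norm_num
    _ ≤ 40 * ∫⁻ x, 4 * f x ^ 2 := by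
        gcongr 40 * ∫⁻ x, ?_ with x
        have hx : f x ≠ ⊤ := ((hfc x).trans_lt hc.lt_top).ne
        calc ∫⁻ t in Set.Ioi (0 : ℝ), {x | ENNReal.ofReal t ≤ 4 * f x}.indicator f x
            = ∫⁻ t in Set.Ioi (0 : ℝ), (Set.Iic (4 * f x).toReal).indicator (fun _ => f x) t := by
              refine setLIntegral_congr_fun measurableSet_Ioi fun t ht => ?_
              simp only [Set.indicator, Set.mem_ofPred_eq, Set.mem_Iic,
                ENNReal.ofReal_le_iff_le_toReal (ENNReal.mul_ne_top ENNReal.ofNat_ne_top hx)]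
          _ = f x * (4 * f x) := by
              rw [lintegral_indicator measurableSet_Iic, setLIntegral_const,
                Measure.restrict_apply measurableSet_Iic, Set.inter_comm, Set.Ioi_inter_Iic,
                Real.volume_Ioc, sub_zero, ENNReal.ofReal_toReal (ENNReal.mul_ne_top (by simp) hx)]
          _ ≤ 4 * f x ^ 2 := le_of_eq (by ring)
    _ = 160 * ∫⁻ x, f x ^ 2 := by
        rw [lintegral_const_mul _ (hf.pow_const 2), ← mul_assoc]
        norm_num

/-! ### Increments of `u` controlled by the maximal function of `u u'`. -/

lemma abs_sq_sub_sq_le {u : ℝ → ℝ} (hu : ContDiff ℝ 1 u) {x y a b : ℝ}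
    (ha : a ∈ Set.uIcc x y) (hb : b ∈ Set.uIcc x y) :
    |u a ^ 2 - u b ^ 2| ≤ 2 * ∫ t in Set.uIcc x y, |u t * deriv u t| := by
  have c0 := hu.continuous
  have c1 := hu.continuous_deriv le_rfl
  have hd : ∀ t ∈ Set.uIcc b a, HasDerivAt (fun t => u t ^ 2) (2 * (u t * deriv u t)) t :=
    fun t _ => ((hu.differentiable one_ne_zero t).hasDerivAt.pow 2).congr_deriv (by
      push_cast
      ring)
  have hcont : Continuous fun t => u t * deriv u t := by fun_prop
  rw [← intervalIntegral.integral_eq_sub_of_hasDerivAt hd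
    (Continuous.intervalIntegrable (by fun_prop) _ _), intervalIntegral.integral_const_mul,
    abs_mul, abs_two]
  gcongr
  refine (intervalIntegral.norm_integral_le_integral_norm_uIoc (f := fun t => u t * deriv u t)).trans
    (setIntegral_mono_set ?_ ?_ ?_)
  · exact hcont.norm.continuousOn.integrableOn_compact isCompact_uIcc
  · exact Filter.Eventually.of_forall fun t => norm_nonneg _
  · exact (Set.uIoc_subset_uIcc.trans (Set.uIcc_subset_uIcc hb ha)).eventuallyLE

/-- If the two values do not have opposite signs, `|u y| ≤ |u x + u y|` and the product is bounded
by the increment of `u²`. Otherwise `u` vanishes at some `z` between `x` and `y`; comparing `u²` at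
`y` and `z` bounds `u(y)²`, and `|u x - u y| ≤ 2 |u y|`. -/
lemma abs_sub_mul_abs_le {u : ℝ → ℝ} (hu : ContDiff ℝ 1 u) {x y : ℝ} (h : |u x| ≤ |u y|) :
    |u x - u y| * |u y| ≤ 4 * ∫ t in Set.uIcc x y, |u t * deriv u t| := by
  have hI : 0 ≤ ∫ t in Set.uIcc x y, |u t * deriv u t| := integral_nonneg fun t => abs_nonneg _
  rcases le_or_gt 0 (u x * u y) with h0 | h0
  · have h1 := abs_sq_sub_sq_le hu (Set.left_mem_uIcc (a := x) (b := y)) Set.right_mem_uIcc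
    have h2 : |u y| ≤ |u x + u y| := by
      rw [← sq_le_sq]
      nlinarith [sq_nonneg (u x)]
    calc |u x - u y| * |u y| ≤ |u x - u y| * |u x + u y| := by gcongr
      _ = |u x ^ 2 - u y ^ 2| := by
        rw [← abs_mul]
        ring_nf
      _ ≤ _ := by linarith
  · have hmem : (0 : ℝ) ∈ Set.uIcc (u x) (u y) := by
      rw [Set.mem_uIcc]
      rcases mul_neg_iff.1 h0 with h | h
      · exact Or.inr ⟨h.2.le, h.1.le⟩
      · exact Or.inl ⟨h.1.le, h.2.le⟩
    obtain ⟨z, hz, hz0⟩ := intermediate_value_uIcc hu.continuous.continuousOn hmem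
    have h1 := abs_sq_sub_sq_le hu (Set.right_mem_uIcc (a := x) (b := y)) hz
    rw [hz0, zero_pow two_ne_zero, sub_zero, abs_pow] at h1
    have h2 : |u x - u y| ≤ 2 * |u y| := (abs_sub _ _).trans (by linarith)
    nlinarith [abs_nonneg (u y)]

lemma abs_sub_mul_abs_le_centredMaximal {u : ℝ → ℝ} (hu : ContDiff ℝ 1 u) {x y : ℝ}
    (hfin : centredMaximal (fun t => ‖u t * deriv u t‖ₑ) y ≠ ⊤) (h : |u x| ≤ |u y|) :
    |u x - u y| * |u y|
      ≤ 4 * (|x - y| * (centredMaximal (fun t => ‖u t * deriv u t‖ₑ) y).toReal) := by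
  rcases eq_or_ne x y with rfl | hxy
  · simp
  have c0 := hu.continuous
  have c1 := hu.continuous_deriv le_rfl
  have hcont : Continuous fun t => u t * deriv u t := by fun_prop
  refine (abs_sub_mul_abs_le hu h).trans (mul_le_mul_of_nonneg_left ?_ (by norm_num))
  have hpos : 0 < |x - y| := abs_pos.2 (sub_ne_zero.2 hxy)
  rw [← ENNReal.ofReal_le_ofReal_iff (by positivity), ENNReal.ofReal_mul hpos.le,
    ENNReal.ofReal_toReal hfin, mul_comm, ofReal_integral_eq_lintegral_ofReal
      (hcont.abs.continuousOn.integrableOn_compact isCompact_uIcc)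
      (Filter.Eventually.of_forall fun t => abs_nonneg _)]
  simp only [← Real.enorm_eq_ofReal_abs (u _ * _)]
  refine le_trans (lintegral_mono_set fun t ht => ?_) (lintegral_closedBall_le _ y hpos)
  rw [Metric.mem_closedBall, Real.dist_eq]
  rw [Set.uIcc_comm] at ht
  rw [abs_sub_comm t]
  simpa [abs_sub_comm] using Set.abs_sub_left_of_mem_uIcc ht

/-! ### Kernel estimate and the Gagliardo integral. -/

lemma lintegral_inv_one_add_div_sq (y : ℝ) {R : ℝ} (hR : 0 < R) :
    ∫⁻ x : ℝ, ENNReal.ofReal ((1 + ((x - y) / R) ^ 2)⁻¹) = ENNReal.ofReal (R * Real.pi) := by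
  have hint : Integrable fun x : ℝ => (1 + ((x - y) / R) ^ 2)⁻¹ :=
    (integrable_inv_one_add_sq.comp_div hR.ne').comp_sub_right y
  rw [← ofReal_integral_eq_lintegral_ofReal hint
      (Filter.Eventually.of_forall fun x => by positivity),
    integral_sub_right_eq_self (fun x => (1 + (x / R) ^ 2)⁻¹) y,
    Measure.integral_comp_div (fun x => (1 + x ^ 2)⁻¹) R, integral_univ_inv_one_add_sq,
    abs_of_pos hR, smul_eq_mul]

/-- Dimensionless kernel bound, for `e = |u x - u y| / |u y|` and `t = |x - y| / R`: use `e ≤ 4 t`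
when `t ≤ 1` and `e ≤ 2` when `t ≥ 1`. -/
lemma pow_four_mul_one_add_sq_le {e t : ℝ} (he : 0 ≤ e) (he2 : e ≤ 2) (het : e ≤ 4 * t) :
    e ^ 4 * (1 + t ^ 2) ≤ 512 * t ^ 3 := by
  have ht : 0 ≤ t := by linarith
  rcases le_total t 1 with h | h
  · calc e ^ 4 * (1 + t ^ 2) ≤ (4 * t) ^ 4 * (1 + 1) := by
          gcongr
          nlinarith
      _ = 512 * (t ^ 3 * t) := by ring
      _ ≤ 512 * (t ^ 3 * 1) := by gcongr
      _ = _ := by ring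
  · calc e ^ 4 * (1 + t ^ 2) ≤ 2 ^ 4 * (1 * t ^ 2 + t ^ 2) := by
          gcongr
          nlinarith
      _ = 32 * (t ^ 2 * 1) := by ring
      _ ≤ 512 * (t ^ 2 * t) := by gcongr; norm_num
      _ = _ := by ring

/-- The pointwise kernel bound: with `R = v ^ 2 / g` the kernel is dominated by a Cauchy kernel of
width `R`. -/
lemma pow_four_div_pow_three_le {d v h g : ℝ} (hd : 0 ≤ d) (hv : 0 < v) (hh : 0 < h) (hg : 0 < g)
    (hdv : d ≤ 2 * v) (hdg : d * v ≤ 4 * (h * g)) :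
    d ^ 4 / h ^ 3 ≤ 512 * v ^ 4 / (v ^ 2 / g) ^ 3 * (1 + (h / (v ^ 2 / g)) ^ 2)⁻¹ := by
  have key := pow_four_mul_one_add_sq_le (e := d / v) (t := h / (v ^ 2 / g)) (by positivity)
    ((div_le_iff₀ hv).2 hdv) (by
      rw [div_le_iff₀ hv]
      have : 4 * (h / (v ^ 2 / g)) * v = 4 * (h * g) / v := by field_simp
      rw [this, le_div_iff₀ hv]
      exact hdg)
  set R := v ^ 2 / g with hR
  have hRpos : 0 < R := by positivity
  rw [← div_eq_mul_inv, div_div, div_le_div_iff₀ (by positivity) (by positivity)]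
  calc d ^ 4 * (R ^ 3 * (1 + (h / R) ^ 2))
      = v ^ 4 * R ^ 3 * ((d / v) ^ 4 * (1 + (h / R) ^ 2)) := by field_simp
    _ ≤ v ^ 4 * R ^ 3 * (512 * (h / R) ^ 3) := by gcongr
    _ = 512 * v ^ 4 * h ^ 3 := by field_simp

lemma enorm_pow_four_div (a b : ℝ) (hb : b ≠ 0) :
    ‖a‖ₑ ^ (4 : ℝ) / ‖b‖ₑ ^ (3 : ℝ) = ENNReal.ofReal (|a| ^ 4 / |b| ^ 3) := by
  have hb' := abs_pos.2 hb
  rw [ENNReal.ofReal_div_of_pos (by positivity), ENNReal.ofReal_pow (abs_nonneg _),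
    ENNReal.ofReal_pow (abs_nonneg _), ← Real.enorm_eq_ofReal_abs, ← Real.enorm_eq_ofReal_abs,
    ENNReal.rpow_ofNat, ENNReal.rpow_ofNat]

/-- The Cauchy kernel of width `R` has mass `π R`, and `R = v² / g` makes `v⁴ / R³ * R` equal to
`g²`, so `v = |u y|` disappears. -/
lemma lintegral_indicator_kernel_le {u : ℝ → ℝ} (hu : ContDiff ℝ 1 u) (y : ℝ)
    (hfin : centredMaximal (fun t => ‖u t * deriv u t‖ₑ) y ≠ ⊤) :
    ∫⁻ x, {x | |u x| ≤ |u y|}.indicator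
        (fun x => ‖u x - u y‖ₑ ^ (4 : ℝ) / ‖x - y‖ₑ ^ (3 : ℝ)) x
      ≤ ENNReal.ofReal (512 * Real.pi)
        * centredMaximal (fun t => ‖u t * deriv u t‖ₑ) y ^ 2 := by
  set g := (centredMaximal (fun t => ‖u t * deriv u t‖ₑ) y).toReal with hg
  have hmain : ∀ x, |u x| ≤ |u y| → |u x - u y| * |u y| ≤ 4 * (|x - y| * g) :=
    fun x hx => abs_sub_mul_abs_le_centredMaximal hu hfin hx
  have hd2 : ∀ x, |u x| ≤ |u y| → |u x - u y| ≤ 2 * |u y| :=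
    fun x hx => (abs_sub _ _).trans (by linarith)
  -- The width `R` is meaningful only for `g > 0` and `u y ≠ 0`; in both degenerate cases the
  -- integrand vanishes identically.
  rcases (show 0 ≤ g from ENNReal.toReal_nonneg).eq_or_lt with hg0 | hgpos
  · have hz : ∀ x, |u x| ≤ |u y| → u x - u y = 0 := fun x hx => by
      have h1 := hmain x hx
      rw [← hg0, mul_zero, mul_zero] at h1
      rcases mul_eq_zero.1 (le_antisymm h1 (by positivity)) with h | h
      · exact abs_eq_zero.1 h
      · have := hd2 x hx
        rw [h, mul_zero] at this
        exact abs_eq_zero.1 (le_antisymm this (abs_nonneg _))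
    refine le_trans (le_of_eq ?_) zero_le
    refine lintegral_eq_zero_of_ae_eq_zero (Filter.Eventually.of_forall fun x => ?_)
    by_cases hx : |u x| ≤ |u y|
    · simp [hx, hz x hx]
    · simp [hx]
  rcases eq_or_ne (u y) 0 with hy | hy
  · refine le_trans (le_of_eq ?_) zero_le
    refine lintegral_eq_zero_of_ae_eq_zero (Filter.Eventually.of_forall fun x => ?_)
    by_cases hx : |u x| ≤ |u y|
    · have : u x = 0 := by simpa [hy] using hx
      simp [this, hy]
    · simp [hx]
  have hv : 0 < |u y| := abs_pos.2 hy
  set R := |u y| ^ 2 / g with hR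
  have hRpos : 0 < R := by positivity
  calc ∫⁻ x, {x | |u x| ≤ |u y|}.indicator
        (fun x => ‖u x - u y‖ₑ ^ (4 : ℝ) / ‖x - y‖ₑ ^ (3 : ℝ)) x
      ≤ ∫⁻ x, ENNReal.ofReal (512 * |u y| ^ 4 / R ^ 3)
          * ENNReal.ofReal ((1 + ((x - y) / R) ^ 2)⁻¹) := by
        refine lintegral_mono fun x => Set.indicator_apply_le' (fun hx => ?_) fun _ => zero_le
        -- On the diagonal the kernel is `0 / 0 = 0` in `ℝ≥0∞`.
        rcases eq_or_ne x y with rfl | hxy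
        · simp
        have hxy' : x - y ≠ 0 := sub_ne_zero.2 hxy
        rw [enorm_pow_four_div _ _ hxy', ← ENNReal.ofReal_mul (by positivity)]
        refine ENNReal.ofReal_le_ofReal ?_
        have := pow_four_div_pow_three_le (abs_nonneg (u x - u y)) hv (abs_pos.2 hxy') hgpos
          (hd2 x hx) (hmain x hx)
        rwa [← hR, div_pow |x - y|, sq_abs, ← div_pow] at this
    _ = ENNReal.ofReal (512 * |u y| ^ 4 / R ^ 3) * ENNReal.ofReal (R * Real.pi) := by
        rw [lintegral_const_mul _ (by fun_prop), lintegral_inv_one_add_div_sq y hRpos]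
    _ = ENNReal.ofReal (512 * Real.pi) * ENNReal.ofReal (g ^ 2) := by
        rw [← ENNReal.ofReal_mul (by positivity), ← ENNReal.ofReal_mul (by positivity)]
        congr 1
        rw [hR]
        field_simp
    _ = _ := by rw [ENNReal.ofReal_pow hgpos.le, hg, ENNReal.ofReal_toReal hfin]

lemma lintegral_gagliardo_kernel_le {u : ℝ → ℝ} (hu : ContDiff ℝ 1 u) (hc : HasCompactSupport u) :
    ∫⁻ x : ℝ, ∫⁻ y : ℝ, ‖u x - u y‖ₑ ^ (4 : ℝ) / ‖x - y‖ₑ ^ (3 : ℝ)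
      ≤ ENNReal.ofReal (163840 * Real.pi) * ∫⁻ x, ‖u x * deriv u x‖ₑ ^ (2 : ℝ) := by
  have c0 := hu.continuous
  have c1 := hu.continuous_deriv le_rfl
  have hcont : Continuous fun t => u t * deriv u t := by fun_prop
  obtain ⟨B, hB⟩ := (show HasCompactSupport fun t => u t * deriv u t from
    hc.mul_right).exists_bound_of_continuous hcont
  have hBe : ∀ t, ‖u t * deriv u t‖ₑ ≤ ENNReal.ofReal B := fun t => by
    rw [← ofReal_norm]
    exact ENNReal.ofReal_le_ofReal (hB t)
  have hfin : ∀ y, centredMaximal (fun t => ‖u t * deriv u t‖ₑ) y ≠ ⊤ := fun y =>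
    ((centredMaximal_le_of_le hBe y).trans_lt (ENNReal.mul_lt_top (by simp) (by simp))).ne
  set K : ℝ → ℝ → ℝ≥0∞ := fun y x => {x | |u x| ≤ |u y|}.indicator
    (fun x => ‖u x - u y‖ₑ ^ (4 : ℝ) / ‖x - y‖ₑ ^ (3 : ℝ)) x with hK
  have hKmeas : Measurable (Function.uncurry K) := by
    have h1 : Measurable fun p : ℝ × ℝ =>
        ‖u p.2 - u p.1‖ₑ ^ (4 : ℝ) / ‖p.2 - p.1‖ₑ ^ (3 : ℝ) := by fun_prop
    have h2 : MeasurableSet {p : ℝ × ℝ | |u p.2| ≤ |u p.1|} :=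
      measurableSet_le (by fun_prop) (by fun_prop)
    exact h1.indicator h2
  -- Each pair is charged to whichever point has the larger `|u|`; the two halves have equal
  -- integrals by Tonelli, so the constant is `2 * 512 * 160 = 163840`, times `π`.
  have hle : ∀ x y, ‖u x - u y‖ₑ ^ (4 : ℝ) / ‖x - y‖ₑ ^ (3 : ℝ) ≤ K y x + K x y := by
    intro x y
    rcases le_total |u x| |u y| with h | h
    · refine le_add_right (le_of_eq ?_)
      simp [hK, h]
    · refine le_add_left (le_of_eq ?_)
      simp [hK, h, enorm_sub_rev]
  have hpart : ∫⁻ y, ∫⁻ x, K y x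
      ≤ ENNReal.ofReal (512 * Real.pi) * (160 * ∫⁻ x, ‖u x * deriv u x‖ₑ ^ (2 : ℝ)) := by
    calc ∫⁻ y, ∫⁻ x, K y x
        ≤ ∫⁻ y, ENNReal.ofReal (512 * Real.pi)
            * centredMaximal (fun t => ‖u t * deriv u t‖ₑ) y ^ 2 :=
          lintegral_mono fun y => lintegral_indicator_kernel_le hu y (hfin y)
      _ = ENNReal.ofReal (512 * Real.pi)
            * ∫⁻ y, centredMaximal (fun t => ‖u t * deriv u t‖ₑ) y ^ 2 :=
          lintegral_const_mul _ ((measurable_centredMaximal _).pow_const 2)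
      _ ≤ _ := by
          simp only [ENNReal.rpow_ofNat]
          gcongr
          exact lintegral_centredMaximal_sq_le hcont.measurable.enorm ENNReal.ofReal_ne_top hBe
  calc ∫⁻ x : ℝ, ∫⁻ y : ℝ, ‖u x - u y‖ₑ ^ (4 : ℝ) / ‖x - y‖ₑ ^ (3 : ℝ)
      ≤ ∫⁻ x, ∫⁻ y, (K y x + K x y) := lintegral_mono fun x => lintegral_mono fun y => hle x y
    _ = (∫⁻ x, ∫⁻ y, K y x) + ∫⁻ x, ∫⁻ y, K x y := by
        rw [← lintegral_add_right _ (show Measurable fun x => ∫⁻ y, K x y from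
          hKmeas.lintegral_prod_right')]
        refine lintegral_congr fun x => ?_
        exact lintegral_add_right _ (hKmeas.comp measurable_prodMk_left)
    _ = 2 * ∫⁻ y, ∫⁻ x, K y x := by
        rw [lintegral_lintegral_swap (f := K) hKmeas.aemeasurable, two_mul]
    _ ≤ 2 * (ENNReal.ofReal (512 * Real.pi) * (160 * ∫⁻ x, ‖u x * deriv u x‖ₑ ^ (2 : ℝ))) := by
        gcongr
    _ = _ := by
        rw [show (163840 : ℝ) * Real.pi = 320 * (512 * Real.pi) by ring,
          ENNReal.ofReal_mul (p := 320) (by norm_num), ENNReal.ofReal_ofNat,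
          show (320 : ℝ≥0∞) = 2 * 160 by norm_num]
        ring

theorem mainTheorem6 :
    (∃ C : ℝ≥0, ∀ u : ℝ → ℝ, ContDiff ℝ ∞ u → HasCompactSupport u →
      gagliardoSeminorm (1 / 2) 4 u
        ≤ C * eLpNorm (fun x => u x * deriv u x) 2 volume ^ (1 / 2 : ℝ)) ∧
    (∃ C : ℝ≥0, ∀ u : ℝ → ℝ, ContDiff ℝ ∞ u → HasCompactSupport u →
      eLpNorm (deriv u) 4 volume
        ≤ C * eLpNorm (fun x => u x * deriv (deriv u) x) 2 volume ^ (1 / 2 : ℝ)) ∧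
    (∃ C : ℝ≥0, ∀ u : ℝ → ℝ, ContDiff ℝ ∞ u → HasCompactSupport u →
      eLpNorm (deriv u) 6 volume
        ≤ C * eLpNorm (fun x => u x * deriv u x * deriv (deriv u) x) 2 volume ^ (1 / 3 : ℝ)) := by
  refine ⟨⟨(163840 * Real.pi).toNNReal ^ (1 / 4 : ℝ), fun u hu hc => ?_⟩,
    ⟨((2 * (0 : ℕ) + 3) ^ 2) ^ (1 / ((2 * 0 + 4 : ℕ) : ℝ)), fun u hu hc => ?_⟩,
    ⟨((2 * (1 : ℕ) + 3) ^ 2) ^ (1 / ((2 * 1 + 4 : ℕ) : ℝ)), fun u hu hc => ?_⟩⟩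
  · have h := rpow_inv_le_of_le_mul (p := 4) (by norm_num)
      (lintegral_gagliardo_kernel_le (hu.of_le (by simp)) hc)
    rw [← eLpNorm_two_eq_lintegral, show (2 / 4 : ℝ) = 1 / 2 by norm_num] at h
    rw [ENNReal.coe_rpow_of_nonneg _ (by norm_num), gagliardoSeminorm,
      show (1 + 1 / 2 * 4 : ℝ) = 3 by norm_num]
    exact h
  · have h := eLpNorm_deriv_le hu hc 0
    norm_num at h
    norm_num
    exact h
  · have h := eLpNorm_deriv_le hu hc 1
    norm_num at h
    norm_num
    exact h
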